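/- For $n\ge 0$ let $[n]=\{1,2,\dots,n\}$. A matroid $M$ is \emph{paving} if every circuit of $M$ has cardinality at least the rank of $M$, and \emph{sparse paving} if both $M$ and its dual $M^*$ are paving. An \emph{automorphism} of $M$ is a permutation $\pi$ of its ground set such that, for every subset $X$ of the ground set, $X$ is a basis of $M$ if and only if $\pi(X)$ is a basis of $M$; $M$ is \emph{asymmetric} if the identity is its only automorphism. Let $\mathbb{S}(n)$ be the (finite, non-empty) set of sparse paving matroids with ground set $[n]$ (labelled, that is, not counted up to isomorphism). \textbf{Theorem.} Asymptotically almost all sparse paving matroids are asymmetric, that is, \[ \lim_{n\to\infty}\frac{|\{M\in\mathbb{S}(n) : M \text{ is asymmetric}\}|}{|\mathbb{S}(n)|}=1 . \] -/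

import Mathlib

namespace Matroid

/-- The automorphism group of a matroid: the permutations `π` of the ground set such that
`X` is a base if and only if `π(X)` is a base, for all subsets `X` of the ground set. -/
def autGroup {α : Type*} (M : Matroid α) : Subgroup (Equiv.Perm M.E) where
  carrier := {π | ∀ X : Set M.E, M.IsBase (Subtype.val '' X) ↔ M.IsBase (Subtype.val '' (π '' X))}
  one_mem' := by
    intro X
    simp
  mul_mem' := by
    intro π σ hπ hσ X
    rw [hσ X, hπ (σ '' X), Set.image_image π σ X]
    rfl
  inv_mem' := by
    intro π hπ X
    rw [hπ ((π⁻¹ : Equiv.Perm M.E) '' X), Set.image_image π _ X]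
    simp

/-- A matroid is asymmetric if its only automorphism is the identity. -/
def IsAsymmetric {α : Type*} (M : Matroid α) : Prop := M.autGroup = ⊥

/-- A matroid is paving if each of its circuits has at least as many elements as its rank. -/
def IsPaving {α : Type*} (M : Matroid α) : Prop :=
  ∀ C : Set α, M.IsCircuit C → M.eRank ≤ C.encard

/-- A matroid is sparse paving if both the matroid and its dual are paving. -/
def IsSparsePaving {α : Type*} (M : Matroid α) : Prop := M.IsPaving ∧ M✶.IsPaving

end Matroid

/-- The set of sparse paving matroids whose ground set is the standard `n`-element set. -/
def sparsePavingMatroids (n : ℕ) : Set (Matroid (Fin n)) :=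
  {M | M.E = Set.univ ∧ M.IsSparsePaving}

/-! In rank r the nonbases of a sparse paving matroid form a stable family of the Johnson graph on
r-sets, and for 1 ≤ r ≤ n - 1 every stable family arises this way. It remains to count stable
families H.

If π ≠ 1 preserves H, pick a with π a ≠ a and let U be the r-sets containing a but not π a. The
image of a member of U contains π a, so lies outside U; hence H is determined by H \ U, a stable
family avoiding U (`card_invariant_le`). Such families are rare by switching
(`card_johnsonStableLevel_mul_le`): while H has fewer than n members in U, a quarter of all Y in U
can be added after deleting at most K neighbours, K constant, and only polynomially many H lead to
the same result. For n/6 < r < 5n/6 and n large, |U| is exponential, so each extra member in U gains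
a factor 2n. After n steps the gain (2n)^n beats the at most n^n permutations, with 2^n to spare.

In the other ranks even all 2^(n choose r) families are few compared with the stable families of
rank n/2, of which a colour class modulo n supplies enough. -/

open Finset

/-- Two finite sets are adjacent in the Johnson graph if each is obtained from the other by
exchanging a single element. -/
def JohnsonAdj {α : Type*} [DecidableEq α] (X Y : Finset α) : Prop :=
  #(X \ Y) = 1 ∧ #(Y \ X) = 1

instance {α : Type*} [DecidableEq α] : DecidableRel (JohnsonAdj (α := α)) :=
  fun _ _ => inferInstanceAs (Decidable (_ ∧ _))

/-- The stable sets of the Johnson graph on the `r`-element subsets of `α`. -/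
def johnsonStable (α : Type*) [Fintype α] [DecidableEq α] (r : ℕ) :
    Finset (Finset (Finset α)) :=
  {H ∈ (powersetCard r univ).powerset | ∀ X ∈ H, ∀ Y ∈ H, ¬ JohnsonAdj X Y}

/-! ### Stable families give sparse paving matroids -/

section Johnson

variable {α : Type*} [DecidableEq α]

lemma JohnsonAdj.symm {X Y : Finset α} (h : JohnsonAdj X Y) : JohnsonAdj Y X := ⟨h.2, h.1⟩

lemma not_johnsonAdj_self (X : Finset α) : ¬ JohnsonAdj X X := by simp [JohnsonAdj]

lemma JohnsonAdj.exists_eq_insert_erase {X Y : Finset α} (h : JohnsonAdj X Y) :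
    ∃ e ∈ X, ∃ f, f ∉ X ∧ f ∈ Y ∧ e ∉ Y ∧ Y = insert f (X.erase e) := by
  obtain ⟨e, he⟩ := card_eq_one.1 h.1
  obtain ⟨f, hf⟩ := card_eq_one.1 h.2
  have he' : ∀ x, x ∈ X ∧ x ∉ Y ↔ x = e := fun x => by simpa using Finset.ext_iff.1 he x
  have hf' : ∀ x, x ∈ Y ∧ x ∉ X ↔ x = f := fun x => by simpa using Finset.ext_iff.1 hf x
  refine ⟨e, ((he' e).2 rfl).1, f, ((hf' f).2 rfl).2, ((hf' f).2 rfl).1, ((he' e).2 rfl).2, ?_⟩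
  ext x
  have h1 := he' x
  have h2 := hf' x
  simp only [mem_insert, mem_erase]
  tauto

lemma johnsonAdj_insert_insert {Z : Finset α} {e f : α} (he : e ∉ Z) (hf : f ∉ Z) (hef : e ≠ f) :
    JohnsonAdj (insert e Z) (insert f Z) := by
  constructor <;> rw [card_eq_one]
  · exact ⟨e, by ext x; simp only [mem_sdiff, mem_insert, mem_singleton]; grind⟩
  · exact ⟨f, by ext x; simp only [mem_sdiff, mem_insert, mem_singleton]; grind⟩

lemma johnsonAdj_erase_erase {Z : Finset α} {e f : α} (he : e ∈ Z) (hf : f ∈ Z) (hef : e ≠ f) :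
    JohnsonAdj (Z.erase e) (Z.erase f) := by
  constructor <;> rw [card_eq_one]
  · exact ⟨f, by ext x; simp only [mem_sdiff, mem_erase, mem_singleton]; grind⟩
  · exact ⟨e, by ext x; simp only [mem_sdiff, mem_erase, mem_singleton]; grind⟩

variable [Fintype α] {r : ℕ} {H : Finset (Finset α)}

lemma mem_johnsonStable : H ∈ johnsonStable α r ↔
    (∀ X ∈ H, #X = r) ∧ ∀ X ∈ H, ∀ Y ∈ H, ¬ JohnsonAdj X Y := by
  simp [johnsonStable, subset_iff]

/-- Of the `r`-sets containing a given smaller set, at least one is missing from a stable family. -/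
lemma exists_superset_notMem_of_mem_johnsonStable (hH : H ∈ johnsonStable α r)
    (hr : r + 1 ≤ Fintype.card α) {I : Finset α} (hI : #I < r) :
    ∃ B, I ⊆ B ∧ #B = r ∧ B ∉ H := by
  obtain ⟨Z, hIZ, -, hZ⟩ := exists_subsuperset_card_eq (n := r - 1) (subset_univ I) (by omega)
    (by rw [card_univ]; omega)
  have h2 : 1 < #Zᶜ := by rw [card_compl]; omega
  obtain ⟨e, he, f, hf, hef⟩ := one_lt_card.1 h2
  rw [mem_compl] at he hf
  by_cases h : insert e Z ∈ H
  · refine ⟨insert f Z, hIZ.trans (subset_insert _ _), by rw [card_insert_of_notMem hf]; omega,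
      fun h' => (mem_johnsonStable.1 hH).2 _ h _ h' (johnsonAdj_insert_insert he hf hef)⟩
  · exact ⟨insert e Z, hIZ.trans (subset_insert _ _), by rw [card_insert_of_notMem he]; omega, h⟩

/-- Of the `r`-sets contained in a given larger set, at least one is missing from a stable family. -/
lemma exists_subset_notMem_of_mem_johnsonStable (hH : H ∈ johnsonStable α r)
    (hr : 1 ≤ r) {J : Finset α} (hJ : r < #J) :
    ∃ B, B ⊆ J ∧ #B = r ∧ B ∉ H := by
  obtain ⟨Z, hZJ, hZ⟩ := exists_subset_card_eq (n := r + 1) (s := J) (by omega)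
  have h2 : 1 < #Z := by omega
  obtain ⟨e, he, f, hf, hef⟩ := one_lt_card.1 h2
  by_cases h : Z.erase e ∈ H
  · refine ⟨Z.erase f, (erase_subset _ _).trans hZJ, by rw [card_erase_of_mem hf]; omega,
      fun h' => (mem_johnsonStable.1 hH).2 _ h _ h' (johnsonAdj_erase_erase he hf hef)⟩
  · exact ⟨Z.erase e, (erase_subset _ _).trans hZJ, by rw [card_erase_of_mem he]; omega, h⟩

/-- The complement of a stable family in the family of all `r`-sets has the base exchange
property. -/
lemma exchangeProperty_of_mem_johnsonStable (hH : H ∈ johnsonStable α r) :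
    Matroid.ExchangeProperty
      (fun B : Set α => ∃ X : Finset α, (X : Set α) = B ∧ #X = r ∧ X ∉ H) := by
  rintro _ _ ⟨X, rfl, hX, hXH⟩ ⟨Y, rfl, hY, hYH⟩ e ⟨heX, heY⟩
  simp only [mem_coe] at heX heY
  have hcard : #(X \ Y) = #(Y \ X) := by
    have h1 := card_sdiff_add_card_inter X Y
    have h2 := card_sdiff_add_card_inter Y X
    rw [inter_comm] at h2
    omega
  have hpos : 0 < #(Y \ X) := hcard ▸ card_pos.2 ⟨e, by simp [heX, heY]⟩
  have hnew : ∀ f ∉ X, #(insert f (X.erase e)) = r := fun f hf => by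
    rw [card_insert_of_notMem (by simp [hf]), card_erase_add_one heX, hX]
  have hcoe : ∀ f, ((insert f (X.erase e) : Finset α) : Set α) = insert f ((X : Set α) \ {e}) := by
    intro f; simp
  obtain ⟨f, hf⟩ := card_pos.1 hpos
  rw [mem_sdiff] at hf
  -- If this exchange lands in H, then Y \ X has a second element g, as otherwise the exchange would
  -- produce Y itself. The exchanges by f and g are adjacent, so the one by g avoids H.
  by_cases h : insert f (X.erase e) ∈ H
  · have hlt : 1 < #(Y \ X) := by
      by_contra hle
      have hone : #(Y \ X) = 1 := by omega
      obtain ⟨e', he', f', hf', hf'Y, he'Y, hYeq⟩ :=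
        JohnsonAdj.exists_eq_insert_erase (X := X) (Y := Y) ⟨by omega, hone⟩
      have h1 : e = e' := card_le_one.1 (by omega : #(X \ Y) ≤ 1) e (by simp [heX, heY]) e'
        (by simp [he', he'Y])
      have h2 : f = f' := card_le_one.1 hone.le f (by simp [hf]) f' (by simp [hf', hf'Y])
      subst h1 h2
      exact hYH (hYeq ▸ h)
    obtain ⟨g, hg, hgf⟩ := exists_mem_ne hlt f
    rw [mem_sdiff] at hg
    refine ⟨g, ⟨hg.1, by simpa using hg.2⟩, _, hcoe g, hnew g hg.2, fun h' =>
      (mem_johnsonStable.1 hH).2 _ h _ h'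
        (johnsonAdj_insert_insert (by simp [hf.2]) (by simp [hg.2]) hgf.symm)⟩
  · exact ⟨f, ⟨hf.1, by simpa using hf.2⟩, _, hcoe f, hnew f hf.2, h⟩

/-- The matroid whose bases are the `r`-sets outside a given stable family. -/
def Matroid.ofJohnsonStable (H : Finset (Finset α)) (hH : H ∈ johnsonStable α r)
    (hr : 1 ≤ r) (hr' : r + 1 ≤ Fintype.card α) : Matroid α :=
  Matroid.ofIsBaseOfFinite (E := Set.univ) Set.finite_univ
    (fun B : Set α => ∃ X : Finset α, (X : Set α) = B ∧ #X = r ∧ X ∉ H)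
    (by
      obtain ⟨B, -, hB, hBH⟩ := exists_superset_notMem_of_mem_johnsonStable hH hr'
        (I := ∅) (by simpa using Nat.pos_of_ne_zero (by omega))
      exact ⟨B, B, rfl, hB, hBH⟩)
    (exchangeProperty_of_mem_johnsonStable hH) (fun _ _ => Set.subset_univ _)

lemma Matroid.ofJohnsonStable_isBase (hH : H ∈ johnsonStable α r)
    (hr : 1 ≤ r) (hr' : r + 1 ≤ Fintype.card α) (X : Finset α) :
    (Matroid.ofJohnsonStable H hH hr hr').IsBase (X : Set α) ↔ #X = r ∧ X ∉ H := by
  simp [Matroid.ofJohnsonStable]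

lemma Matroid.ofJohnsonStable_isSparsePaving (hH : H ∈ johnsonStable α r)
    (hr : 1 ≤ r) (hr' : r + 1 ≤ Fintype.card α) :
    (Matroid.ofJohnsonStable H hH hr hr').IsSparsePaving := by
  set M := Matroid.ofJohnsonStable H hH hr hr' with hM
  have hE : M.E = Set.univ := rfl
  have hbase := Matroid.ofJohnsonStable_isBase hH hr hr'
  rw [← hM] at hbase
  refine ⟨fun C hC => ?_, fun C hC => ?_⟩
  · obtain ⟨C, rfl⟩ := (Set.toFinite C).exists_finset_coe
    by_contra hlt
    obtain ⟨B, hB⟩ := M.exists_isBase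
    obtain ⟨B, rfl⟩ := (Set.toFinite B).exists_finset_coe
    rw [← hB.encard_eq_eRank, Set.encard_coe_eq_coe_finsetCard, Set.encard_coe_eq_coe_finsetCard,
      ((hbase B).1 hB).1, Nat.cast_le, not_le] at hlt
    obtain ⟨B', hCB', hB', hB'H⟩ := exists_superset_notMem_of_mem_johnsonStable hH hr' hlt
    exact hC.not_indep (((hbase B').2 ⟨hB', hB'H⟩).indep.subset (by exact_mod_cast hCB'))
  · obtain ⟨C, rfl⟩ := (Set.toFinite C).exists_finset_coe
    by_contra hlt
    obtain ⟨B, hB⟩ := M✶.exists_isBase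
    obtain ⟨B, rfl⟩ := (Set.toFinite B).exists_finset_coe
    have hBc := hB.compl_isBase_of_dual
    rw [hE, ← Set.compl_eq_univ_sdiff, ← coe_compl, hbase, card_compl] at hBc
    rw [← hB.encard_eq_eRank, Set.encard_coe_eq_coe_finsetCard, Set.encard_coe_eq_coe_finsetCard,
      Nat.cast_le, not_le] at hlt
    obtain ⟨B', hB'C, hB', hB'H⟩ := exists_subset_notMem_of_mem_johnsonStable hH hr
      (J := Cᶜ) (by rw [card_compl]; omega)
    refine hC.not_indep (((hbase B').2 ⟨hB', hB'H⟩).compl_isBase_dual.indep.subset ?_)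
    rw [hE, ← Set.compl_eq_univ_sdiff, ← coe_compl, coe_subset]
    exact subset_compl_comm.1 hB'C

end Johnson

instance {α : Type*} [Finite α] : Finite (Matroid α) :=
  Finite.of_injective (fun M : Matroid α => (M.E, {B | M.IsBase B})) fun _ _ h =>
    Matroid.ext_isBase (Prod.ext_iff.1 h).1 fun B _ => Set.ext_iff.1 (Prod.ext_iff.1 h).2 B

lemma card_johnsonStable_le {n r : ℕ} (hr : 1 ≤ r) (hr' : r + 1 ≤ n) :
    #(johnsonStable (Fin n) r) ≤ (sparsePavingMatroids n).ncard := by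
  have hr'' : r + 1 ≤ Fintype.card (Fin n) := by simpa using hr'
  rw [← Set.ncard_coe_finset]
  -- The value `emptyOn` is a dummy, never taken on stable families.
  refine Set.ncard_le_ncard_of_injOn
    (fun H => if hH : H ∈ johnsonStable (Fin n) r then
      Matroid.ofJohnsonStable H hH hr hr'' else Matroid.emptyOn _) ?_ ?_ (Set.toFinite _)
  · intro H hH
    rw [mem_coe] at hH
    simp only [dif_pos hH]
    exact ⟨rfl, Matroid.ofJohnsonStable_isSparsePaving hH hr hr''⟩
  · intro H hH H' hH' h
    rw [mem_coe] at hH hH'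
    simp only [dif_pos hH, dif_pos hH'] at h
    ext X
    have h1 := Matroid.ofJohnsonStable_isBase hH hr hr'' X
    have h2 := Matroid.ofJohnsonStable_isBase hH' hr hr'' X
    rw [h, h2] at h1
    have h3 := (mem_johnsonStable.1 hH).1 X
    have h4 := (mem_johnsonStable.1 hH').1 X
    tauto

/-! ### From sparse paving matroids to stable families -/

section Nonbases

variable {α : Type*} {M : Matroid α} {r : ℕ}

lemma Matroid.IsBase.card_eq {X : Finset α} (hX : M.IsBase (X : Set α)) (hr : M.eRank = r) :
    #X = r := by
  have := hX.encard_eq_eRank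
  rw [hr, Set.encard_coe_eq_coe_finsetCard] at this
  exact_mod_cast this

lemma Matroid.exists_perm_of_not_isAsymmetric [DecidableEq α] (hE : M.E = Set.univ)
    (hM : ¬ M.IsAsymmetric) :
    ∃ π : Equiv.Perm α, π ≠ 1 ∧
      ∀ X : Finset α, M.IsBase (X : Set α) ↔ M.IsBase ((X.image π : Finset α) : Set α) := by
  obtain ⟨⟨σ, hσ⟩, hσ1⟩ := Subgroup.ne_bot_iff_exists_ne_one.1 hM
  have e : ∀ x, x ∈ M.E := fun x => hE ▸ Set.mem_univ x
  refine ⟨⟨fun x => σ ⟨x, e x⟩, fun x => σ⁻¹ ⟨x, e x⟩, fun x => by simp, fun x => by simp⟩,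
    fun h => hσ1 (Subtype.ext ?_), fun X => ?_⟩
  · ext x
    exact Equiv.congr_fun h x.1
  · have := hσ {x | x.1 ∈ X}
    convert this using 2
    · ext x; simp [e]
    · ext x
      simp only [coe_image, Set.mem_image, mem_coe]
      constructor
      · rintro ⟨y, hy, rfl⟩
        exact ⟨_, ⟨⟨y, e y⟩, hy, rfl⟩, rfl⟩
      · rintro ⟨_, ⟨y, hy, rfl⟩, rfl⟩
        exact ⟨y, hy, rfl⟩

variable [Fintype α]

open Classical in
/-- The sets that have the size of a base of a rank-`r` matroid without being one. -/
noncomputable def Matroid.nonbases (M : Matroid α) (r : ℕ) : Finset (Finset α) :=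
  {X ∈ powersetCard r univ | ¬ M.IsBase (X : Set α)}

lemma Matroid.mem_nonbases {X : Finset α} :
    X ∈ M.nonbases r ↔ #X = r ∧ ¬ M.IsBase (X : Set α) := by
  simp [Matroid.nonbases]

/-- A nonbase of size r is dependent, and the circuit inside it already has r elements by paving. -/
lemma Matroid.IsPaving.isCircuit_of_not_isBase (hM : M.IsPaving) (hE : M.E = Set.univ)
    (hr : M.eRank = r) {X : Finset α} (hX : #X = r) (hXB : ¬ M.IsBase (X : Set α)) :
    M.IsCircuit (X : Set α) := by
  have hdep : M.Dep (X : Set α) := by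
    refine ⟨fun hI => hXB ?_, by simp [hE]⟩
    obtain ⟨B, hB, hXB'⟩ := hI.exists_isBase_superset
    obtain ⟨B, rfl⟩ := (Set.toFinite B).exists_finset_coe
    have hXB'' : X ⊆ B := by exact_mod_cast hXB'
    rwa [eq_of_subset_of_card_le hXB'' (by rw [hX, hB.card_eq hr])]
  obtain ⟨C, hCX, hC⟩ := hdep.exists_isCircuit_subset
  have hle := hM C hC
  obtain ⟨C, rfl⟩ := (Set.toFinite C).exists_finset_coe
  rw [hr, Set.encard_coe_eq_coe_finsetCard, Nat.cast_le] at hle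
  have hCX' : C ⊆ X := by exact_mod_cast hCX
  rwa [← eq_of_subset_of_card_le hCX' (by omega)]

lemma Matroid.eq_of_nonbases_eq {M' : Matroid α} (hE : M.E = Set.univ) (hE' : M'.E = Set.univ)
    (hr : M.eRank = r) (hr' : M'.eRank = r) (h : M.nonbases r = M'.nonbases r) : M = M' := by
  refine Matroid.ext_isBase (hE.trans hE'.symm) fun B _ => ?_
  obtain ⟨X, rfl⟩ := (Set.toFinite B).exists_finset_coe
  have h1 := Finset.ext_iff.1 h X
  rw [Matroid.mem_nonbases, Matroid.mem_nonbases] at h1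
  have h2 : M.IsBase (X : Set α) → #X = r := fun h => h.card_eq hr
  have h3 : M'.IsBase (X : Set α) → #X = r := fun h => h.card_eq hr'
  tauto

variable [DecidableEq α]

/-- For adjacent nonbases X and Y, paving makes Y a circuit and dual paving makes Xᶜ a cocircuit.
They would meet in the single element of Y \ X, which is impossible. -/
lemma Matroid.IsSparsePaving.nonbases_mem_johnsonStable (hM : M.IsSparsePaving)
    (hE : M.E = Set.univ) (hr : M.eRank = r) : M.nonbases r ∈ johnsonStable α r := by
  refine mem_johnsonStable.2 ⟨fun X hX => (Matroid.mem_nonbases.1 hX).1, fun X hX Y hY hXY => ?_⟩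
  rw [Matroid.mem_nonbases] at hX hY
  have hYC := hM.1.isCircuit_of_not_isBase hE hr hY.1 hY.2
  have hXC : M✶.IsCircuit ((Xᶜ : Finset α) : Set α) := by
    obtain ⟨B, hB⟩ := M✶.exists_isBase
    obtain ⟨B, rfl⟩ := (Set.toFinite B).exists_finset_coe
    have hBr : M✶.eRank = (#B : ℕ) := by
      rw [← hB.encard_eq_eRank, Set.encard_coe_eq_coe_finsetCard]
    refine hM.2.isCircuit_of_not_isBase hE hBr ?_ fun h => hX.2 ?_
    · have hBc := hB.compl_isBase_of_dual
      rw [hE, ← Set.compl_eq_univ_sdiff, ← coe_compl] at hBc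
      have := hBc.card_eq hr
      rw [card_compl] at this ⊢
      have := card_le_univ B
      omega
    · have := h.compl_isBase_of_dual
      rwa [hE, ← Set.compl_eq_univ_sdiff, ← coe_compl, compl_compl] at this
  obtain ⟨f, hf⟩ := card_eq_one.1 hXY.2
  refine hYC.inter_isCocircuit_ne_singleton hXC (e := f) ?_
  rw [← coe_inter, ← coe_singleton, ← hf, sdiff_eq_inter_compl]

end Nonbases

/-- The stable families that are invariant under some non-trivial permutation of the points. -/
def symmetricJohnsonStable (α : Type*) [Fintype α] [DecidableEq α] (r : ℕ) :
    Finset (Finset (Finset α)) :=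
  {H ∈ johnsonStable α r | ∃ π : Equiv.Perm α, π ≠ 1 ∧ ∀ X, X ∈ H ↔ X.image π ∈ H}

lemma ncard_not_isAsymmetric_le (n r : ℕ) :
    {M : Matroid (Fin n) | M ∈ sparsePavingMatroids n ∧ M.eRank = r ∧ ¬ M.IsAsymmetric}.ncard ≤
      #(symmetricJohnsonStable (Fin n) r) := by
  rw [← Set.ncard_coe_finset]
  refine Set.ncard_le_ncard_of_injOn (fun M => M.nonbases r) ?_ ?_ (Set.toFinite _)
  · rintro M ⟨⟨hE, hM⟩, hr, hs⟩
    obtain ⟨π, hπ, h⟩ := Matroid.exists_perm_of_not_isAsymmetric hE hs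
    rw [mem_coe, symmetricJohnsonStable, mem_filter]
    refine ⟨hM.nonbases_mem_johnsonStable hE hr, π, hπ, fun X => ?_⟩
    rw [Matroid.mem_nonbases, Matroid.mem_nonbases, ← h, card_image_of_injective _ π.injective]
  · rintro M ⟨⟨hE, -⟩, hr, -⟩ M' ⟨⟨hE', -⟩, hr', -⟩ h
    exact Matroid.eq_of_nonbases_eq hE hE' hr hr' h

/-! ### Switching: stable families avoiding U are rare -/

section Switching

variable {α : Type*} [Fintype α] [DecidableEq α]

/-- The neighbours of a set in the Johnson graph. -/
def johnsonNbrs (X : Finset α) : Finset (Finset α) := {Y | JohnsonAdj X Y}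

lemma mem_johnsonNbrs {X Y : Finset α} : Y ∈ johnsonNbrs X ↔ JohnsonAdj X Y := by
  simp [johnsonNbrs]

lemma card_johnsonNbrs_le (X : Finset α) : #(johnsonNbrs X) ≤ Fintype.card α ^ 2 := by
  have hsub : johnsonNbrs X ⊆
      (univ : Finset (α × α)).image fun p => insert p.2 (X.erase p.1) := by
    intro Y hY
    obtain ⟨e, -, f, -, -, -, rfl⟩ := (mem_johnsonNbrs.1 hY).exists_eq_insert_erase
    exact mem_image.2 ⟨(e, f), mem_univ _, rfl⟩
  refine (card_le_card hsub).trans (card_image_le.trans ?_)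
  rw [card_univ, Fintype.card_prod, sq]

/-- The `r`-sets that contain `a` but not `b`. -/
def separatingSets (a b : α) (r : ℕ) : Finset (Finset α) :=
  {X ∈ powersetCard r univ | a ∈ X ∧ b ∉ X}

variable {a b : α} {r : ℕ}

lemma mem_separatingSets {X : Finset α} :
    X ∈ separatingSets a b r ↔ #X = r ∧ a ∈ X ∧ b ∉ X := by
  simp [separatingSets]

lemma choose_le_card_separatingSets (hab : a ≠ b) (hr : 1 ≤ r) :
    (Fintype.card α - 2).choose (r - 1) ≤ #(separatingSets a b r) := by
  have h2 : #(univ \ {a, b} : Finset α) = Fintype.card α - 2 := by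
    rw [card_sdiff_of_subset (subset_univ _), card_univ, card_pair hab]
  rw [← h2, ← card_powersetCard]
  have hmem : ∀ Z ∈ powersetCard (r - 1) (univ \ {a, b} : Finset α),
      a ∉ Z ∧ b ∉ Z ∧ #Z = r - 1 := by
    intro Z hZ
    rw [mem_powersetCard] at hZ
    exact ⟨fun h => by simpa using hZ.1 h, fun h => by simpa using hZ.1 h, hZ.2⟩
  refine card_le_card_of_injOn (insert a) (fun Z hZ => ?_) (fun Z hZ Z' hZ' h => ?_)
  · obtain ⟨h1, h2, h3⟩ := hmem Z hZ
    refine mem_coe.2 (mem_separatingSets.2 ⟨?_, mem_insert_self _ _, ?_⟩)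
    · rw [card_insert_of_notMem h1]; omega
    · simp [hab.symm, h2]
  · rw [← erase_insert (hmem Z hZ).1, ← erase_insert (hmem Z' hZ').1]
    exact congrArg (fun Y => Y.erase a) h

/-- One of the two exchanged elements is forced: b must leave if b ∈ X, and otherwise a is missing
and must enter. This linear bound, in place of the quadratic one for all neighbours, is what allows
K to be constant. -/
lemma card_separatingSets_inter_nbrs_le {X : Finset α} (hX : #X = r)
    (hXU : X ∉ separatingSets a b r) :
    #{Y ∈ separatingSets a b r | JohnsonAdj X Y} ≤ Fintype.card α := by
  have key : ∃ g : α → Finset α, {Y ∈ separatingSets a b r | JohnsonAdj X Y} ⊆ univ.image g := by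
    by_cases hb : b ∈ X
    · refine ⟨fun f => insert f (X.erase b), fun Y hY => ?_⟩
      rw [mem_filter, mem_separatingSets] at hY
      obtain ⟨⟨-, -, hbY⟩, hXY⟩ := hY
      obtain ⟨e, he, f, hf, hfY, heY, rfl⟩ := hXY.exists_eq_insert_erase
      have : e = b := by
        by_contra hne
        exact hbY (mem_insert_of_mem (mem_erase.2 ⟨Ne.symm hne, hb⟩))
      subst this
      exact mem_image_of_mem _ (mem_univ f)
    · have ha : a ∉ X := fun ha => hXU (mem_separatingSets.2 ⟨hX, ha, hb⟩)
      refine ⟨fun e => insert a (X.erase e), fun Y hY => ?_⟩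
      rw [mem_filter, mem_separatingSets] at hY
      obtain ⟨⟨-, haY, -⟩, hXY⟩ := hY
      obtain ⟨e, he, f, hf, hfY, heY, rfl⟩ := hXY.exists_eq_insert_erase
      have : a = f := by
        rcases mem_insert.1 haY with h | h
        · exact h
        · exact absurd (mem_of_mem_erase h) ha
      subst this
      exact mem_image_of_mem _ (mem_univ e)
  obtain ⟨g, hg⟩ := key
  exact (card_le_card hg).trans (card_image_le.trans_eq card_univ)

variable {H : Finset (Finset α)}

/-- Each `(r-1)`-set lies in at most one member of a stable family of `r`-sets. -/
lemma card_mul_le_choose_of_mem_johnsonStable (hH : H ∈ johnsonStable α r) (hr : 1 ≤ r) :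
    #H * r ≤ (Fintype.card α).choose (r - 1) := by
  rw [mem_johnsonStable] at hH
  rw [← card_univ, ← card_powersetCard, ← mul_one (#(powersetCard _ _))]
  refine card_mul_le_card_mul (fun X Z => Z ⊆ X) (fun X hX => ?_) (fun Z hZ => ?_)
  · have : bipartiteAbove (fun X Z => Z ⊆ X) (powersetCard (r - 1) univ) X =
        powersetCard (r - 1) X := by
      ext Z; simp [mem_bipartiteAbove, mem_powersetCard, and_comm]
    rw [this, card_powersetCard, hH.1 X hX, ← Nat.choose_symm_of_eq_add (a := 1) (by omega),
      Nat.choose_one_right]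
  · rw [card_le_one]
    intro X hX Y hY
    rw [mem_bipartiteBelow] at hX hY
    rw [mem_powersetCard] at hZ
    by_contra hXY
    have hXr := hH.1 X hX.1
    have hYr := hH.1 Y hY.1
    have hX1 : #(X \ Z) = 1 := by rw [card_sdiff_of_subset hX.2]; omega
    have hY1 : #(Y \ Z) = 1 := by rw [card_sdiff_of_subset hY.2]; omega
    obtain ⟨e, he⟩ := card_eq_one.1 hX1
    obtain ⟨f, hf⟩ := card_eq_one.1 hY1
    have heX : insert e Z = X := by rw [← union_sdiff_of_subset hX.2, he]; simp
    have hfY : insert f Z = Y := by rw [← union_sdiff_of_subset hY.2, hf]; simp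
    have he' : e ∉ Z := (mem_sdiff.1 (he ▸ mem_singleton_self e)).2
    have hf' : f ∉ Z := (mem_sdiff.1 (hf ▸ mem_singleton_self f)).2
    refine hH.2 X hX.1 Y hY.1 ?_
    rw [← heX, ← hfY]
    refine johnsonAdj_insert_insert he' hf' ?_
    rintro rfl
    exact hXY (heX.symm.trans hfY)

/-- Double counting of adjacent pairs: each counted Y has at least K + 1 neighbours in H \ U, and
each X outside U has at most n neighbours in U. -/
lemma card_many_blockers_le (hH : H ∈ johnsonStable α r) (K : ℕ) :
    #{Y ∈ separatingSets a b r | K < #{X ∈ H \ separatingSets a b r | JohnsonAdj X Y}} * (K + 1) ≤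
      #H * Fintype.card α := by
  refine (card_mul_le_card_mul' (s := H \ separatingSets a b r) JohnsonAdj (n := K + 1)
    (m := Fintype.card α) (fun Y hY => ?_) (fun X hX => ?_)).trans (Nat.mul_le_mul_right _ (card_le_card sdiff_subset))
  · exact (mem_filter.1 hY).2
  · rw [mem_sdiff] at hX
    refine (card_le_card ?_).trans
      (card_separatingSets_inter_nbrs_le ((mem_johnsonStable.1 hH).1 X hX.1) hX.2)
    intro Y hY
    rw [mem_bipartiteAbove, mem_filter] at hY
    exact mem_filter.2 ⟨hY.1.1, hY.2⟩

/-- The sets separating `a` from `b` that can be inserted into a stable family `H` at the cost of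
deleting at most `K` members, none of which separates `a` from `b`. -/
def switchableSets (a b : α) (r K : ℕ) (H : Finset (Finset α)) : Finset (Finset α) :=
  {Y ∈ separatingSets a b r | Y ∉ H ∧
    (∀ X ∈ H, X ∈ separatingSets a b r → ¬ JohnsonAdj X Y) ∧ #(johnsonNbrs Y ∩ H) ≤ K}

/-- A set Y in U can fail to be switchable only by lying in H ∩ U, by being adjacent to a member of
H ∩ U, or by having more than K neighbours in H \ U. -/
lemma card_separatingSets_le {K : ℕ} :
    #(separatingSets a b r) ≤ #(switchableSets a b r K H) +
      #(H ∩ separatingSets a b r) * (1 + Fintype.card α ^ 2) +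
      #{Y ∈ separatingSets a b r |
        K < #{X ∈ H \ separatingSets a b r | JohnsonAdj X Y}} := by
  set U := separatingSets a b r
  have hsub : U ⊆ switchableSets a b r K H ∪ (H ∩ U ∪ (H ∩ U).biUnion johnsonNbrs) ∪
      {Y ∈ U | K < #{X ∈ H \ U | JohnsonAdj X Y}} := by
    intro Y hY
    by_contra hcon
    simp only [mem_union, mem_filter, mem_inter, mem_biUnion, mem_johnsonNbrs, hY, true_and,
      and_true, not_or, not_exists, not_and, not_lt] at hcon
    obtain ⟨⟨h1, h2, h3⟩, h4⟩ := hcon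
    refine h1 (mem_filter.2 ⟨hY, h2, fun X hX hXU => h3 X ⟨hX, hXU⟩,
      (card_le_card fun X hX => ?_).trans h4⟩)
    rw [mem_inter, mem_johnsonNbrs] at hX
    exact mem_filter.2
      ⟨mem_sdiff.2 ⟨hX.2, fun hXU => h3 X ⟨hX.2, hXU⟩ hX.1.symm⟩, hX.1.symm⟩
  have h1 := card_le_card hsub
  have h2 := card_union_le (switchableSets a b r K H ∪ (H ∩ U ∪ (H ∩ U).biUnion johnsonNbrs))
    {Y ∈ U | K < #{X ∈ H \ U | JohnsonAdj X Y}}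
  have h3 := card_union_le (switchableSets a b r K H) (H ∩ U ∪ (H ∩ U).biUnion johnsonNbrs)
  have h4 := card_union_le (H ∩ U) ((H ∩ U).biUnion johnsonNbrs)
  have h5 : #((H ∩ U).biUnion johnsonNbrs) ≤ #(H ∩ U) * Fintype.card α ^ 2 :=
    card_biUnion_le_card_mul _ _ _ fun X _ => card_johnsonNbrs_le X
  rw [mul_add, mul_one]
  omega

/-- The stable families that have exactly `j` members separating `a` from `b`. -/
def johnsonStableLevel (a b : α) (r j : ℕ) : Finset (Finset (Finset α)) :=
  {H ∈ johnsonStable α r | #(H ∩ separatingSets a b r) = j}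

/-- Y is new and the deleted neighbours all lie outside U, so the count in U rises by exactly one.
-/
lemma switch_mem_johnsonStableLevel {K j : ℕ} (hH : H ∈ johnsonStableLevel a b r j)
    {Y : Finset α} (hY : Y ∈ switchableSets a b r K H) :
    insert Y (H \ johnsonNbrs Y) ∈ johnsonStableLevel a b r (j + 1) := by
  rw [johnsonStableLevel, mem_filter, mem_johnsonStable] at hH ⊢
  rw [switchableSets, mem_filter] at hY
  obtain ⟨hYU, hYH, hYa, -⟩ := hY
  obtain ⟨⟨hr, hst⟩, hj⟩ := hH
  refine ⟨⟨?_, ?_⟩, ?_⟩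
  · intro X hX
    rcases mem_insert.1 hX with rfl | hX
    · exact (mem_separatingSets.1 hYU).1
    · exact hr X (mem_sdiff.1 hX).1
  · have hnot : ∀ X ∈ H \ johnsonNbrs Y, ¬ JohnsonAdj Y X := fun X hX h =>
      (mem_sdiff.1 hX).2 (mem_johnsonNbrs.2 h)
    intro X hX Z hZ
    rcases mem_insert.1 hX with rfl | hX <;> rcases mem_insert.1 hZ with rfl | hZ
    · exact not_johnsonAdj_self _
    · exact hnot Z hZ
    · exact fun h => hnot X hX h.symm
    · exact hst X (mem_sdiff.1 hX).1 Z (mem_sdiff.1 hZ).1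
  · have : insert Y (H \ johnsonNbrs Y) ∩ separatingSets a b r =
        insert Y (H ∩ separatingSets a b r) := by
      ext X
      simp only [mem_inter, mem_insert, mem_sdiff, mem_johnsonNbrs]
      constructor
      · rintro ⟨rfl | h, hU⟩
        · exact Or.inl rfl
        · exact Or.inr ⟨h.1, hU⟩
      · rintro (rfl | h)
        · exact ⟨Or.inl rfl, hYU⟩
        · exact ⟨Or.inr ⟨h.1, fun hadj => hYa X h.1 h.2 hadj.symm⟩, h.2⟩
    rw [this, card_insert_of_notMem (by simp [hYH]), hj]

lemma card_powerset_filter_card_le {β : Type*} [DecidableEq β] (s : Finset β) (K : ℕ) {m : ℕ}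
    (hm : 1 ≤ m) (hs : #s ≤ m) : #{B ∈ s.powerset | #B ≤ K} ≤ (K + 1) * m ^ K := by
  have hsub : {B ∈ s.powerset | #B ≤ K} ⊆ (range (K + 1)).biUnion fun i => powersetCard i s := by
    intro B hB
    rw [mem_filter, mem_powerset] at hB
    simp only [mem_biUnion, mem_range, mem_powersetCard]
    exact ⟨#B, by omega, hB.1, rfl⟩
  refine (card_le_card hsub).trans ((card_biUnion_le_card_mul _ _ (m ^ K) fun i hi => ?_).trans
    (by rw [card_range]))
  rw [card_powersetCard]
  exact (Nat.choose_le_pow _ _).trans ((Nat.pow_le_pow_left hs i).trans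
    (Nat.pow_le_pow_right hm (by simpa [Nat.lt_succ_iff] using hi)))

/-- Double counting of switches. Distinct Y give distinct results; conversely H is recovered from
the result by naming Y, among its j + 1 ≤ n members in U, and the deleted set of at most K
neighbours of Y. -/
lemma card_johnsonStableLevel_mul_le {K j g : ℕ} (hj : j < Fintype.card α)
    (hg : ∀ H ∈ johnsonStableLevel a b r j, g ≤ #(switchableSets a b r K H)) :
    #(johnsonStableLevel a b r j) * g ≤ #(johnsonStableLevel a b r (j + 1)) *
      (Fintype.card α * ((K + 1) * (Fintype.card α ^ 2) ^ K)) := by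
  refine card_mul_le_card_mul
    (fun H H' => ∃ Y ∈ switchableSets a b r K H, H' = insert Y (H \ johnsonNbrs Y))
    (fun H hH => (hg H hH).trans ?_) (fun H' hH' => ?_)
  · refine card_le_card_of_injOn (fun Y => insert Y (H \ johnsonNbrs Y))
      (fun Y hY => ?_) (fun Y hY Z hZ h => ?_)
    · exact mem_coe.2 ((mem_bipartiteAbove _).2 ⟨switch_mem_johnsonStableLevel hH hY, Y, hY, rfl⟩)
    · have h1 : Y ∈ insert Z (H \ johnsonNbrs Z) := by
        rw [← show insert Y (H \ johnsonNbrs Y) = insert Z (H \ johnsonNbrs Z) from h]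
        exact mem_insert_self _ _
      rcases mem_insert.1 h1 with h1 | h1
      · exact h1
      · exact absurd (mem_sdiff.1 h1).1 (mem_filter.1 (mem_coe.1 hY)).2.1
  · have hsub : bipartiteBelow (fun H H' => ∃ Y ∈ switchableSets a b r K H,
        H' = insert Y (H \ johnsonNbrs Y)) (johnsonStableLevel a b r j) H' ⊆
        (H' ∩ separatingSets a b r).biUnion fun Y =>
          {B ∈ (johnsonNbrs Y).powerset | #B ≤ K}.image fun B => H'.erase Y ∪ B := by
      intro H hH
      obtain ⟨-, Y, hY, rfl⟩ := (mem_bipartiteBelow _).1 hH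
      rw [switchableSets, mem_filter] at hY
      refine mem_biUnion.2 ⟨Y, mem_inter.2 ⟨mem_insert_self _ _, hY.1⟩, mem_image.2
        ⟨johnsonNbrs Y ∩ H, mem_filter.2 ⟨mem_powerset.2 inter_subset_left, hY.2.2.2⟩, ?_⟩⟩
      rw [erase_insert fun h => hY.2.1 (mem_sdiff.1 h).1, inter_comm, sdiff_union_inter]
    refine (card_le_card hsub).trans ((card_biUnion_le_card_mul _ _ _ fun Y _ =>
      card_image_le.trans (card_powerset_filter_card_le _ K (m := Fintype.card α ^ 2)
        (Nat.one_le_pow _ _ (by omega)) (card_johnsonNbrs_le Y))).trans (Nat.mul_le_mul_right _ ?_))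
    rw [johnsonStableLevel, mem_filter] at hH'
    omega

/-- If the sets separating `a` from `b` are numerous compared with the `(r-1)`-sets, then few
stable families avoid them. -/
lemma card_johnsonStableLevel_zero_mul_le {K : ℕ} (hK : 431 ≤ K) (hr : 1 ≤ r) (hn : 0 < Fintype.card α)
    (hnr : Fintype.card α ≤ 6 * r)
    (hU : (Fintype.card α).choose (r - 1) ≤ 36 * #(separatingSets a b r))
    (hU1 : 4 * (Fintype.card α * (1 + Fintype.card α ^ 2)) ≤ #(separatingSets a b r))
    (hU2 : 4 * (2 * Fintype.card α * (Fintype.card α * ((K + 1) * (Fintype.card α ^ 2) ^ K))) ≤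
      #(separatingSets a b r)) :
    #(johnsonStableLevel a b r 0) * (2 * Fintype.card α) ^ Fintype.card α ≤
      #(johnsonStable α r) := by
  set n := Fintype.card α with hndef
  have hstep : ∀ j < n, #(johnsonStableLevel a b r j) * (2 * n) ≤
      #(johnsonStableLevel a b r (j + 1)) := by
    intro j hj
    set D := n * ((K + 1) * (n ^ 2) ^ K) with hD
    have hDpos : 0 < D := by positivity
    refine Nat.le_of_mul_le_mul_right ?_ hDpos
    rw [mul_assoc]
    refine card_johnsonStableLevel_mul_le (K := K) hj fun H hH => ?_
    rw [johnsonStableLevel, mem_filter] at hH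
    have h1 := card_separatingSets_le (a := a) (b := b) (r := r) (H := H) (K := K)
    have h2 := card_many_blockers_le (a := a) (b := b) hH.1 K
    have h3 := card_mul_le_choose_of_mem_johnsonStable hH.1 hr
    have h4 : #(H ∩ separatingSets a b r) * (1 + n ^ 2) ≤ n * (1 + n ^ 2) :=
      Nat.mul_le_mul_right _ (by omega)
    have h5 : #H * n ≤ 6 * (#H * r) := by
      rw [mul_left_comm]; exact Nat.mul_le_mul_left _ hnr
    rw [← hndef] at h1 h2 h3
    -- Here 432 = 2 · 6 · 36: 432 times the number of blocked Y is at most n|H| ≤ 6r|H| ≤ 6 · 36|U|,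
    -- so at most half of U is blocked. By `hU1` at most a quarter is lost to H ∩ U, and by `hU2`
    -- the remaining quarter is at least 2nD.
    have h6 := (Nat.mul_le_mul_left _ (by omega : 432 ≤ K + 1)).trans h2
    omega
  have hpow : ∀ j ≤ n, #(johnsonStableLevel a b r 0) * (2 * n) ^ j ≤
      #(johnsonStableLevel a b r j) := by
    intro j
    induction j with
    | zero => simp
    | succ j ih =>
      intro hj
      rw [pow_succ, ← mul_assoc]
      exact (Nat.mul_le_mul_right _ (ih (by omega))).trans (hstep j (by omega))
  exact (hpow n le_rfl).trans (card_le_card (filter_subset _ _))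

/-- A `π`-invariant stable family is determined by its members that do not separate `a` from
`π a`. -/
lemma card_invariant_le (π : Equiv.Perm α) (a : α) (r : ℕ) :
    #{H ∈ johnsonStable α r | ∀ X, X ∈ H ↔ X.image π ∈ H} ≤
      #(johnsonStableLevel a (π a) r 0) := by
  set U := separatingSets a (π a) r with hU
  refine card_le_card_of_injOn (fun H => H \ U) (fun H hH => ?_) (fun H hH H' hH' h => ?_)
  · rw [mem_coe, mem_filter, mem_johnsonStable] at hH
    rw [mem_coe, johnsonStableLevel, mem_filter, mem_johnsonStable]
    refine ⟨⟨fun X hX => hH.1.1 X (mem_sdiff.1 hX).1, fun X hX Y hY =>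
      hH.1.2 X (mem_sdiff.1 hX).1 Y (mem_sdiff.1 hY).1⟩, ?_⟩
    rw [card_eq_zero, ← hU, sdiff_inter_self]
  · rw [mem_coe, mem_filter] at hH hH'
    have h' : ∀ X, X ∈ H ∧ X ∉ U ↔ X ∈ H' ∧ X ∉ U := fun X => by
      simpa using Finset.ext_iff.1 h X
    ext X
    by_cases hX : X ∈ U
    · have hπX : X.image π ∉ U := fun h => (mem_separatingSets.1 h).2.2
        (mem_image_of_mem _ (mem_separatingSets.1 hX).2.1)
      have := h' (X.image π)
      rw [hH.2 X, hH'.2 X]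
      tauto
    · have := h' X
      tauto

/-- A union bound over permutations: n^n of the factor (2n)^n pays for them, leaving 2^n. -/
lemma card_symmetricJohnsonStable_mul_le (hn : 0 < Fintype.card α)
    (h : ∀ a b : α, a ≠ b → #(johnsonStableLevel a b r 0) *
      (2 * Fintype.card α) ^ Fintype.card α ≤ #(johnsonStable α r)) :
    #(symmetricJohnsonStable α r) * 2 ^ Fintype.card α ≤ #(johnsonStable α r) := by
  set n := Fintype.card α with hndef
  have hsub : symmetricJohnsonStable α r ⊆ ({π | π ≠ 1} : Finset (Equiv.Perm α)).biUnion
      fun π => {H ∈ johnsonStable α r | ∀ X, X ∈ H ↔ X.image π ∈ H} := by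
    intro H hH
    rw [symmetricJohnsonStable, mem_filter] at hH
    obtain ⟨hH, π, hπ, hi⟩ := hH
    exact mem_biUnion.2 ⟨π, by simpa using hπ, mem_filter.2 ⟨hH, hi⟩⟩
  have hperm : #({π | π ≠ 1} : Finset (Equiv.Perm α)) ≤ n ^ n :=
    (card_le_univ _).trans (by rw [Fintype.card_perm]; exact Nat.factorial_le_pow n)
  refine Nat.le_of_mul_le_mul_left ?_ (pow_pos hn n)
  calc n ^ n * (#(symmetricJohnsonStable α r) * 2 ^ n)
      = #(symmetricJohnsonStable α r) * (2 * n) ^ n := by rw [mul_pow]; ring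
    _ ≤ (∑ π : Equiv.Perm α with π ≠ 1,
          #{H ∈ johnsonStable α r | ∀ X, X ∈ H ↔ X.image π ∈ H}) * (2 * n) ^ n :=
        Nat.mul_le_mul_right _ ((card_le_card hsub).trans card_biUnion_le)
    _ ≤ #({π | π ≠ 1} : Finset (Equiv.Perm α)) * #(johnsonStable α r) := by
        rw [sum_mul, ← smul_eq_mul (b := #(johnsonStable α r))]
        refine sum_le_card_nsmul _ _ _ fun π hπ => ?_
        obtain ⟨a, ha⟩ : ∃ a, π a ≠ a := by
          by_contra! hcon
          exact (mem_filter.1 hπ).2 (Equiv.ext hcon)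
        exact (Nat.mul_le_mul_right _ (card_invariant_le π a r)).trans (h a (π a) ha.symm)
    _ ≤ n ^ n * #(johnsonStable α r) := Nat.mul_le_mul_right _ hperm

end Switching

/-- Subfamilies of a colour class of the colouring by sums modulo `n` are stable. -/
lemma exists_pow_le_card_johnsonStable {n : ℕ} (hn : 0 < n) (r : ℕ) :
    ∃ m, n.choose r ≤ n * m ∧ 2 ^ m ≤ #(johnsonStable (Fin n) r) := by
  have : NeZero n := ⟨hn.ne'⟩
  let c : Finset (Fin n) → ZMod n := fun X => ∑ i ∈ X, ((i : ℕ) : ZMod n)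
  -- Exchanging e for f changes the sum by f - e, which is nonzero modulo n.
  have hc : ∀ X Y, JohnsonAdj X Y → c X ≠ c Y := by
    intro X Y h heq
    obtain ⟨e, he, f, hf, -, -, rfl⟩ := h.exists_eq_insert_erase
    have h1 : c X = (e : ℕ) + c (X.erase e) := (add_sum_erase X _ he).symm
    have h2 : c (insert f (X.erase e)) = (f : ℕ) + c (X.erase e) :=
      sum_insert fun h => hf (mem_of_mem_erase h)
    rw [h1, h2, add_left_inj, ZMod.natCast_eq_natCast_iff', Nat.mod_eq_of_lt e.2,
      Nat.mod_eq_of_lt f.2] at heq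
    exact hf (Fin.ext heq ▸ he)
  obtain ⟨y, -, hy⟩ := exists_max_image (univ : Finset (ZMod n))
    (fun y => #{X ∈ powersetCard r (univ : Finset (Fin n)) | c X = y}) ⟨0, mem_univ _⟩
  refine ⟨#{X ∈ powersetCard r (univ : Finset (Fin n)) | c X = y}, ?_, ?_⟩
  · have h1 := card_le_mul_card_image_of_maps_to (s := powersetCard r (univ : Finset (Fin n)))
      (t := univ) (f := c) (fun _ _ => mem_univ _) _ hy
    rwa [card_powersetCard, card_univ, card_univ, ZMod.card, Fintype.card_fin, mul_comm] at h1
  · rw [← card_powerset]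
    refine card_le_card fun H hH => ?_
    rw [mem_powerset] at hH
    refine mem_johnsonStable.2 ⟨fun X hX => ?_, fun X hX Y hY h => hc X Y h ?_⟩
    · exact (mem_powersetCard.1 (mem_filter.1 (hH hX)).1).2
    · rw [(mem_filter.1 (hH hX)).2, (mem_filter.1 (hH hY)).2]

/-! ### Binomial estimates -/

section Estimates

lemma two_pow_le_add_choose {k m : ℕ} (h : k ≤ m) : 2 ^ k ≤ (k + m).choose k := by
  induction k with
  | zero => simp
  | succ k ih =>
    have h1 := Nat.add_one_mul_choose_eq (k + m) k
    rw [show k + 1 + m = k + m + 1 by omega]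
    refine Nat.le_of_mul_le_mul_right ?_ (Nat.succ_pos k)
    rw [← h1]
    calc 2 ^ (k + 1) * (k + 1) = (2 * (k + 1)) * 2 ^ k := by ring
      _ ≤ (k + m + 1) * (k + m).choose k := Nat.mul_le_mul (by omega) (ih (by omega))

lemma two_pow_le_choose {n k t : ℕ} (h1 : t ≤ k) (h2 : t + k ≤ n) : 2 ^ t ≤ n.choose k := by
  obtain ⟨m, rfl⟩ := Nat.exists_eq_add_of_le (show k ≤ n by omega)
  rcases le_total k m with h | h
  · exact (Nat.pow_le_pow_right two_pos h1).trans (two_pow_le_add_choose h)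
  · rw [Nat.choose_symm_add, add_comm]
    exact (Nat.pow_le_pow_right two_pos (by omega)).trans (two_pow_le_add_choose h)

/-- Lowering the top entry from M + 1 to M costs the factor (M + 1)/(M + 1 - k) ≤ 6, and this is
done twice. -/
lemma choose_le_mul_choose_sub_two {n r : ℕ} (hr : 1 ≤ r) (hrn : 6 * r ≤ 5 * n) (hn : 2 ≤ n) :
    n.choose (r - 1) ≤ 36 * (n - 2).choose (r - 1) := by
  obtain ⟨N, rfl⟩ := Nat.exists_eq_add_of_le' hn
  obtain ⟨k, rfl⟩ := Nat.exists_eq_add_of_le' hr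
  simp only [Nat.add_sub_cancel]
  have step : ∀ M, M + 1 ≤ 6 * (M + 1 - k) → (M + 1).choose k ≤ 6 * M.choose k := by
    intro M hM
    refine Nat.le_of_mul_le_mul_right ?_ (Nat.succ_pos M)
    calc (M + 1).choose k * (M + 1) ≤ (M + 1).choose k * (6 * (M + 1 - k)) :=
          Nat.mul_le_mul_left _ hM
      _ = 6 * M.choose k * (M + 1) := by
          rw [mul_assoc 6, Nat.choose_mul_succ_eq]; ring
  have h1 := step (N + 1) (by omega)
  have h2 := step N (by omega)
  rw [show N + 1 + 1 = N + 2 from rfl] at h1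
  omega

/-- Below n/3 each increase of the lower index at least doubles the coefficient. -/
lemma choose_mul_two_pow_le {n r k : ℕ} (h : 3 * (r + k) ≤ n) :
    n.choose r * 2 ^ k ≤ n.choose (r + k) := by
  induction k with
  | zero => simp
  | succ k ih =>
    have h1 := Nat.choose_succ_right_eq n (r + k)
    refine Nat.le_of_mul_le_mul_right ?_ (Nat.succ_pos (r + k))
    rw [← add_assoc, h1]
    calc n.choose r * 2 ^ (k + 1) * (r + k + 1)
        = n.choose r * 2 ^ k * (2 * (r + k + 1)) := by ring
      _ ≤ n.choose (r + k) * (n - (r + k)) := Nat.mul_le_mul (ih (by omega)) (by omega)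

lemma choose_mul_two_pow_le_choose_half {n r : ℕ} (hrn : r ≤ n)
    (h : 6 * r ≤ n ∨ 5 * n ≤ 6 * r) : n.choose r * 2 ^ (n / 6) ≤ n.choose (n / 2) := by
  rcases h with h | h
  · exact (choose_mul_two_pow_le (by omega)).trans (Nat.choose_le_middle _ _)
  · rw [← Nat.choose_symm hrn]
    exact (choose_mul_two_pow_le (by omega)).trans (Nat.choose_le_middle _ _)

/-- With t = n/6 - 1 ≥ 12 one has n ≤ 12t ≤ t², so n^d ≤ t^(2d) ≤ 2^t. -/
lemma eventually_pow_le_two_pow_div (d : ℕ) :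
    ∀ᶠ n : ℕ in Filter.atTop, n ^ d ≤ 2 ^ (n / 6 - 1) := by
  have h1 : ∀ᶠ t : ℕ in Filter.atTop, t ^ (2 * d) ≤ 2 ^ t := by
    have h := tendsto_pow_const_div_const_pow_of_one_lt (2 * d) (one_lt_two (α := ℝ))
    filter_upwards [h.eventually_le_const one_pos] with t ht
    rw [div_le_one (by positivity)] at ht
    exact_mod_cast ht
  have h2 : Filter.Tendsto (fun n : ℕ => n / 6 - 1) Filter.atTop Filter.atTop :=
    Filter.tendsto_atTop.2 fun b => by
      filter_upwards [Filter.eventually_ge_atTop (6 * b + 12)] with n hn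
      omega
  filter_upwards [h2.eventually h1, h2.eventually_ge_atTop 12] with n hn hn12
  refine le_trans ?_ hn
  rw [pow_mul]
  refine Nat.pow_le_pow_left ?_ d
  rw [sq]
  have := Nat.mul_le_mul_right (n / 6 - 1) hn12
  omega

end Estimates

/-! ### Comparison over all ranks and the limit -/

lemma card_johnsonStable_le_two_pow (n r : ℕ) : #(johnsonStable (Fin n) r) ≤ 2 ^ n.choose r := by
  refine (card_le_card (filter_subset _ _)).trans_eq ?_
  rw [card_powerset, card_powersetCard, card_univ, Fintype.card_fin]

/-- Symmetric stable families are rare among the stable families of some non-degenerate rank. -/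
lemma eventually_card_symmetricJohnsonStable_mul_le :
    ∀ᶠ n : ℕ in Filter.atTop, ∀ r ≤ n, ∃ r', 1 ≤ r' ∧ r' + 1 ≤ n ∧
      #(symmetricJohnsonStable (Fin n) r) * 2 ^ n ≤ #(johnsonStable (Fin n) r') := by
  obtain ⟨K, hK⟩ : ∃ K, 431 ≤ K := ⟨431, le_rfl⟩
  -- The exponent 2K + 3 leaves one spare factor n over the switching cost 8(K + 1)n^(2K+2), whose
  -- coefficient it absorbs.
  filter_upwards [eventually_pow_le_two_pow_div (2 * K + 3),
    Filter.eventually_ge_atTop (8 * (K + 1))] with n hn hnK r hrn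
  by_cases hr : n < 6 * r ∧ 6 * r < 5 * n
  · refine ⟨r, by omega, by omega, ?_⟩
    have hcard : Fintype.card (Fin n) = n := Fintype.card_fin n
    have key := card_symmetricJohnsonStable_mul_le (α := Fin n) (r := r) (by rw [hcard]; omega)
    rw [hcard] at key
    refine key fun a b hab => ?_
    have hU := choose_le_card_separatingSets hab (r := r) (by omega)
    have hC := choose_le_mul_choose_sub_two (n := n) (r := r) (by omega) (by omega) (by omega)
    have h2 : 2 ^ (n / 6 - 1) ≤ (n - 2).choose (r - 1) := two_pow_le_choose (by omega) (by omega)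
    rw [hcard] at hU
    have hpoly := hn.trans (h2.trans hU)
    have hzero := card_johnsonStableLevel_zero_mul_le (a := a) (b := b) hK (r := r) (by omega)
      (by rw [hcard]; omega) (by rw [hcard]; omega)
    rw [hcard] at hzero
    refine hzero (by omega) (le_trans ?_ hpoly) (le_trans ?_ hpoly)
    · calc 4 * (n * (1 + n ^ 2)) ≤ 4 * (n * (n ^ 2 + n ^ 2)) := by
            gcongr; exact Nat.one_le_pow _ _ (by omega)
        _ = 8 * n ^ 3 := by ring
        _ ≤ n * n ^ 3 := Nat.mul_le_mul_right _ (by omega)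
        _ = n ^ 4 := by ring
        _ ≤ n ^ (2 * K + 3) := Nat.pow_le_pow_right (by omega) (by omega)
    · calc 4 * (2 * n * (n * ((K + 1) * (n ^ 2) ^ K))) = 8 * (K + 1) * n ^ (2 * K + 2) := by ring
        _ ≤ n * n ^ (2 * K + 2) := Nat.mul_le_mul_right _ hnK
        _ = n ^ (2 * K + 3) := by ring
  · refine ⟨n / 2, by omega, by omega, ?_⟩
    obtain ⟨m, hm, hms⟩ := exists_pow_le_card_johnsonStable (n := n) (by omega) (n / 2)
    refine le_trans ?_ hms
    have hle : #(symmetricJohnsonStable (Fin n) r) ≤ 2 ^ n.choose r :=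
      (card_le_card (filter_subset _ _)).trans (card_johnsonStable_le_two_pow n r)
    refine (Nat.mul_le_mul_right _ hle).trans ?_
    rw [← pow_add]
    refine Nat.pow_le_pow_right two_pos (Nat.le_of_mul_le_mul_left ?_ (show 0 < n by omega))
    have hpos : 1 ≤ n.choose r := Nat.choose_pos hrn
    calc n * (n.choose r + n) ≤ n * (n.choose r * n + n.choose r * n) := by
          gcongr
          · exact Nat.le_mul_of_pos_right _ (by omega)
          · exact Nat.le_mul_of_pos_left _ hpos
      _ = n.choose r * (2 * n ^ 2) := by ring
      _ ≤ n.choose r * (n * n ^ 2) := by gcongr; omega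
      _ = n.choose r * n ^ 3 := by ring
      _ ≤ n.choose r * 2 ^ (n / 6) := by
          refine Nat.mul_le_mul_left _ ?_
          calc n ^ 3 ≤ n ^ (2 * K + 3) := Nat.pow_le_pow_right (by omega) (by omega)
            _ ≤ 2 ^ (n / 6 - 1) := hn
            _ ≤ 2 ^ (n / 6) := Nat.pow_le_pow_right two_pos (Nat.sub_le _ _)
      _ ≤ n.choose (n / 2) := choose_mul_two_pow_le_choose_half hrn (by omega)
      _ ≤ n * m := hm

lemma Matroid.exists_eRank_eq {n : ℕ} (M : Matroid (Fin n)) : ∃ r ≤ n, M.eRank = r := by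
  obtain ⟨B, hB⟩ := M.exists_isBase
  obtain ⟨B, rfl⟩ := (Set.toFinite B).exists_finset_coe
  exact ⟨#B, by simpa using card_le_univ B,
    by rw [← hB.encard_eq_eRank, Set.encard_coe_eq_coe_finsetCard]⟩

/-- Each of the n + 1 ranks is charged to the stable families of one nondegenerate rank, which
inject into all sparse paving matroids. -/
lemma eventually_ncard_not_isAsymmetric_mul_le :
    ∀ᶠ n : ℕ in Filter.atTop,
      {M : Matroid (Fin n) | M ∈ sparsePavingMatroids n ∧ ¬ M.IsAsymmetric}.ncard * 2 ^ n ≤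
        (n + 1) * (sparsePavingMatroids n).ncard := by
  filter_upwards [eventually_card_symmetricJohnsonStable_mul_le] with n hn
  have hsub : {M : Matroid (Fin n) | M ∈ sparsePavingMatroids n ∧ ¬ M.IsAsymmetric} ⊆
      ⋃ r ∈ range (n + 1),
        {M | M ∈ sparsePavingMatroids n ∧ M.eRank = r ∧ ¬ M.IsAsymmetric} := by
    rintro M ⟨hM, hs⟩
    obtain ⟨r, hr, hMr⟩ := M.exists_eRank_eq
    exact Set.mem_biUnion (x := r) (by simpa [Nat.lt_succ_iff] using hr) ⟨hM, hMr, hs⟩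
  refine (Nat.mul_le_mul_right _ ((Set.ncard_le_ncard hsub (Set.toFinite _)).trans
    (Finset.set_ncard_biUnion_le _ _))).trans ?_
  rw [sum_mul]
  refine (sum_le_card_nsmul _ _ (sparsePavingMatroids n).ncard fun r hr => ?_).trans_eq
    (by rw [card_range, smul_eq_mul])
  obtain ⟨r', h1, h2, h3⟩ := hn r (by simpa [Nat.lt_succ_iff] using hr)
  exact (Nat.mul_le_mul_right _ (ncard_not_isAsymmetric_le n r)).trans
    (h3.trans (card_johnsonStable_le h1 h2))

lemma eventually_ncard_sparsePavingMatroids_pos :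
    ∀ᶠ n : ℕ in Filter.atTop, 0 < (sparsePavingMatroids n).ncard := by
  filter_upwards [Filter.eventually_ge_atTop 2] with n hn
  refine lt_of_lt_of_le (card_pos.2 ⟨∅, ?_⟩) (card_johnsonStable_le (r := 1) le_rfl hn)
  simp [mem_johnsonStable]

theorem mainTheorem2 :
    Filter.Tendsto
      (fun n : ℕ =>
        (({M : Matroid (Fin n) | M ∈ sparsePavingMatroids n ∧ M.IsAsymmetric}.ncard : ℕ) : ℝ) /
          (((sparsePavingMatroids n).ncard : ℕ) : ℝ))
      Filter.atTop (nhds 1) := by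
  have hlim : Filter.Tendsto (fun n : ℕ => 1 - ((n : ℝ) ^ 1 / 2 ^ n + (n : ℝ) ^ 0 / 2 ^ n))
      Filter.atTop (nhds 1) := by
    simpa only [add_zero, sub_zero] using tendsto_const_nhds.sub
      ((tendsto_pow_const_div_const_pow_of_one_lt 1 (one_lt_two (α := ℝ))).add
        (tendsto_pow_const_div_const_pow_of_one_lt 0 (one_lt_two (α := ℝ))))
  refine tendsto_of_tendsto_of_tendsto_of_le_of_le' hlim tendsto_const_nhds ?_ ?_
  · filter_upwards [eventually_ncard_not_isAsymmetric_mul_le,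
      eventually_ncard_sparsePavingMatroids_pos] with n hn hpos
    have hsplit : {M : Matroid (Fin n) | M ∈ sparsePavingMatroids n ∧ M.IsAsymmetric}.ncard +
        {M : Matroid (Fin n) | M ∈ sparsePavingMatroids n ∧ ¬ M.IsAsymmetric}.ncard =
        (sparsePavingMatroids n).ncard :=
      Set.ncard_inter_add_ncard_sdiff_eq_ncard _ {M : Matroid (Fin n) | M.IsAsymmetric} (Set.toFinite _)
    set s := (sparsePavingMatroids n).ncard
    have hs : (0 : ℝ) < s := by exact_mod_cast hpos
    have hn' : (({M : Matroid (Fin n) | M ∈ sparsePavingMatroids n ∧ ¬ M.IsAsymmetric}.ncard : ℕ)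
        : ℝ) * 2 ^ n ≤ (n + 1) * s := by exact_mod_cast hn
    have hbad := (le_div_iff₀ (by positivity : (0 : ℝ) < 2 ^ n)).2 hn'
    have hsplit' := congrArg (Nat.cast (R := ℝ)) hsplit
    rw [Nat.cast_add] at hsplit'
    rw [le_div_iff₀ hs, pow_one, pow_zero, ← add_div, sub_mul, one_mul, div_mul_eq_mul_div]
    linarith
  · filter_upwards with n
    refine div_le_one_of_le₀ ?_ (Nat.cast_nonneg _)
    have hsub : {M : Matroid (Fin n) | M ∈ sparsePavingMatroids n ∧ M.IsAsymmetric} ⊆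
        sparsePavingMatroids n := fun M hM => hM.1
    exact_mod_cast Set.ncard_le_ncard hsub (Set.toFinite _)
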